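/- Let $p$ be a prime, $\mathbf F$ a finite field of characteristic $p$, $f=[\mathbf F:\mathbf F_p]$, and fix an algebraic closure $\overline{\mathbf F}_p$ of $\mathbf F_p$ and an embedding $\tau_0:\mathbf F\to\overline{\mathbf F}_p$. For $0\le i\le f-1$ put $\tau_i=\tau_0\circ\mathrm{Frob}^i$, where $\mathrm{Frob}(x)=x^p$, and for $n\ge 0$ let $\mathrm{Sym}^n_{[i]}=\overline{\mathbf F}_p\otimes_{\mathbf F,\tau_i}\mathrm{Sym}^n\mathbf F^2$, where $\mathrm{Sym}^n\mathbf F^2$ is the $n$-th symmetric power of the standard representation of $\mathrm{GL}_2(\mathbf F)$. For $t\ge 0$ let $S_{(t,\dots,t)}=\bigotimes_{i=0}^{f-1}\mathrm{Sym}^t_{[i]}$, the tensor product being over $\overline{\mathbf F}_p$. Let $G_0(\overline{\mathbf F}_p[\mathrm{GL}_2(\mathbf F)])$ be the Grothendieck group of finite-dimensional representations of $\mathrm{GL}_2(\mathbf F)$ over $\overline{\mathbf F}_p$, and write $x\le y$ in it if $y-x$ is the class of an actual finite-dimensional representation. Let $e,s\ge 1$ be integers and let $\sigma$ be an irreducible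 finite-dimensional representation of $\mathrm{GL}_2(\mathbf F)$ over $\overline{\mathbf F}_p$ with central character $\mathbf N_{\mathbf F/\mathbf F_p}^{es}$, i.e. every scalar matrix $z\in\mathbf F^\times$ acts on $\sigma$ as multiplication by $\mathbf N_{\mathbf F/\mathbf F_p}(z)^{es}$. Then there is an integer $t_0\geq 0$ such that for all integers $t\ge t_0$ with $t\equiv s \bmod (p-1)/\gcd(p-1,e)$, the representation $\sigma$ is a Jordan–Hölder factor of $S_{(t,\dots,t)}^{\otimes e}$, and $[\sigma]\le\left[S_{(t,\dots,t)}^{\otimes e}\right]$ in $G_0(\overline{\mathbf F}_p[\mathrm{GL}_2(\mathbf F)])$. -/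

import Mathlib

open scoped TensorProduct MonoidAlgebra

universe u v

noncomputable section

namespace SerreWeights

/-! ### Symmetric powers of the standard representation -/

section Sym

variable {R : Type*} [CommRing R]

/-- The substitution `X j ↦ ∑ i, g i j • X i`: the action of `g` on `R[X 0, X 1] = Sym R²`,
where `X j` is the `j`-th standard basis vector of `R²`. -/
def substHom (g : Matrix (Fin 2) (Fin 2) R) :
    MvPolynomial (Fin 2) R →ₐ[R] MvPolynomial (Fin 2) R :=
  MvPolynomial.aeval fun j => ∑ i, g i j • (MvPolynomial.X i : MvPolynomial (Fin 2) R)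

theorem substHom_mem (g : Matrix (Fin 2) (Fin 2) R) (n : ℕ) :
    ∀ P ∈ MvPolynomial.homogeneousSubmodule (Fin 2) R n,
      (substHom g).toLinearMap P ∈ MvPolynomial.homogeneousSubmodule (Fin 2) R n := by
  intro P hP
  have h := MvPolynomial.IsHomogeneous.aeval (R := R) (n := 1) hP
    (fun j => ∑ i, g i j • (MvPolynomial.X i : MvPolynomial (Fin 2) R)) (fun j =>
      Submodule.sum_mem (MvPolynomial.homogeneousSubmodule (Fin 2) R 1) fun i _ =>
        Submodule.smul_mem _ _ (MvPolynomial.isHomogeneous_X R i))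
  rw [one_mul] at h
  exact h

theorem substHom_one : substHom (1 : Matrix (Fin 2) (Fin 2) R) = AlgHom.id R _ := by
  refine MvPolynomial.algHom_ext fun j => ?_
  simp [substHom, Matrix.one_apply]

theorem substHom_mul (g h : Matrix (Fin 2) (Fin 2) R) :
    substHom (g * h) = (substHom g).comp (substHom h) := by
  refine MvPolynomial.algHom_ext fun j => ?_
  simp only [substHom, AlgHom.comp_apply, MvPolynomial.aeval_X, map_sum, map_smul,
    Matrix.mul_apply, Finset.sum_smul, Finset.smul_sum, smul_smul]
  rw [Finset.sum_comm]
  simp only [mul_comm]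

/-- `Sym^n R²`, the homogeneous polynomials of degree `n` in two variables over `R`. -/
def SymSpace (R : Type*) [CommRing R] (n : ℕ) : Type _ :=
  MvPolynomial.homogeneousSubmodule (Fin 2) R n

instance (n : ℕ) : AddCommGroup (SymSpace R n) :=
  inferInstanceAs (AddCommGroup (MvPolynomial.homogeneousSubmodule (Fin 2) R n))

instance (n : ℕ) : Module R (SymSpace R n) :=
  inferInstanceAs (Module R (MvPolynomial.homogeneousSubmodule (Fin 2) R n))

instance (n : ℕ) : Module.Finite R (SymSpace R n) :=
  Module.Finite.iff_fg.mpr (MvPolynomial.homogeneousSubmodule_fg _ _ n)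

/-- The action of `GL₂(R)` on `Sym^n R²`, the `n`-th symmetric power of its standard
representation. -/
def symRep (R : Type*) [CommRing R] (n : ℕ) :
    Representation R (GL (Fin 2) R) (SymSpace R n) where
  toFun g := ((substHom (g : Matrix (Fin 2) (Fin 2) R)).toLinearMap.restrict (substHom_mem _ n) :
    MvPolynomial.homogeneousSubmodule (Fin 2) R n →ₗ[R]
      MvPolynomial.homogeneousSubmodule (Fin 2) R n)
  map_one' := by
    refine LinearMap.ext fun P => Subtype.ext ?_
    change substHom _ _ = _
    rw [Units.val_one, substHom_one]
    rfl
  map_mul' g h := by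
    refine LinearMap.ext fun P => Subtype.ext ?_
    change substHom _ _ = _
    rw [Units.val_mul, substHom_mul]
    rfl

end Sym

/-! ### Tensor products of representations -/

/-- The tensor product `⨂ i, V i` of a finite family of representations of `G`, with `g` acting
by `⨂ v i ↦ ⨂ g (v i)`. -/
def tensorRep {ι k G : Type*} [Fintype ι] [CommRing k] [Monoid G] {V : ι → Type*}
    [∀ i, AddCommGroup (V i)] [∀ i, Module k (V i)] (ρ : ∀ i, Representation k G (V i)) :
    Representation k G (⨂[k] i, V i) :=
  PiTensorProduct.mapMonoidHom.comp (MonoidHom.pi ρ)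

/-- The `e`-fold tensor power of a representation. -/
def tensorPowRep {k G V : Type*} [CommRing k] [Monoid G] [AddCommGroup V] [Module k V]
    (e : ℕ) (ρ : Representation k G V) : Representation k G (⨂[k] _ : Fin e, V) :=
  tensorRep fun _ => ρ

/-! ### The representations `S_n` of `GL₂(F)` -/

section S

variable (p : ℕ) {F k : Type*} [Field F] [Field k] [Fact p.Prime] [CharP F p]

/-- `τ_i = τ₀ ∘ Frob ^ i`, i.e. `x ↦ τ₀ (x ^ p ^ i)`. -/
def embTwist (τ₀ : F →+* k) (i : ℕ) : F →+* k :=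
  τ₀.comp (iterateFrobenius F p i)

/-- `Sym_[i]^n = k ⊗_{F, τ_i} Sym^n F²`: the degree `n` forms over `k` in two variables, with
`g ∈ GL₂(F)` acting through the matrix `τ_i (g) ∈ GL₂(k)`. -/
def symTwist (τ₀ : F →+* k) (i n : ℕ) :
    Representation k (GL (Fin 2) F) (SymSpace k n) :=
  (symRep k n).comp (Matrix.GeneralLinearGroup.map (embTwist p τ₀ i))

/-- `S_n = ⨂_{i = 0}^{f - 1} Sym_[i]^{n i}`, for a vector `n` of length `f`. -/
def S (τ₀ : F →+* k) {f : ℕ} (n : Fin f → ℕ) :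
    Representation k (GL (Fin 2) F) (⨂[k] i, SymSpace k (n i)) :=
  tensorRep fun i => symTwist p τ₀ i (n i)

end S

/-! ### Jordan–Hölder factors -/

/-- `σ` is a Jordan–Hölder factor of `ρ`: some composition series
`0 = W_0 < W_1 < ... < W_l = V` of the `k[G]`-module of `ρ` has a quotient `W_{i+1} / W_i`
isomorphic to `σ`. -/
def IsJordanHolderFactor {k G U V : Type*} [Field k] [Group G]
    [AddCommGroup U] [Module k U] [AddCommGroup V] [Module k V]
    (σ : Representation k G U) (ρ : Representation k G V) : Prop :=
  ∃ s : CompositionSeries (Submodule k[G] ρ.asModule),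
    s.head = ⊥ ∧ s.last = ⊤ ∧
    ∃ i : Fin s.length,
      Nonempty ((s i.succ ⧸ (s i.castSucc).submoduleOf (s i.succ)) ≃ₗ[k[G]] σ.asModule)

/-! ### The Grothendieck group of finite-dimensional representations -/

section Grothendieck



variable (k : Type u) (G : Type v) [Field k] [Group G]

/-- The relations `[Y] = [X] + [Z]` for all short exact sequences `0 → X → Y → Z → 0` of
finite-dimensional representations. -/
def shortExactRelations : Set (FreeAbelianGroup (FDRep k G)) :=
  {x | ∃ (X Y Z : FDRep k G) (i : Representation.IntertwiningMap X.ρ Y.ρ)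
      (q : Representation.IntertwiningMap Y.ρ Z.ρ),
    Function.Injective i ∧ Function.Exact i q ∧ Function.Surjective q ∧
    x = FreeAbelianGroup.of Y - FreeAbelianGroup.of X - FreeAbelianGroup.of Z}

/-- The Grothendieck group `G₀(k[G])` of finite-dimensional representations of `G` over `k`. -/
abbrev G₀ : Type (max (u + 1) v) :=
  FreeAbelianGroup (FDRep k G) ⧸ AddSubgroup.closure (shortExactRelations k G)

variable {k G}

/-- The class `[ρ]` in `G₀(k[G])` of a finite-dimensional representation `ρ`. -/
def G₀.cls {V : Type u} [AddCommGroup V] [Module k V] [FiniteDimensional k V]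
    (ρ : Representation k G V) : G₀ k G :=
  QuotientAddGroup.mk (FreeAbelianGroup.of (FDRep.of ρ))

/-- The natural ordering on `G₀(k[G])`: `x ≤ y` if `y - x` is the class of an actual
finite-dimensional representation. -/
def G₀.le (x y : G₀ k G) : Prop :=
  ∃ W : FDRep k G, y - x = G₀.cls W.ρ

end Grothendieck


end SerreWeights

end

/-!
The group `G = GL₂(F)` is finite, and `σ` embeds into the functions on `G` through its matrix
coefficients `g ↦ μ (σ g v)`, for any functional `μ ≠ 0`. On these functions the centre `Z = Fˣ` acts
through the central character `χ` of `σ`. So it suffices to find a functional `ℓ` on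
`S_{(t,...,t)}^{⊗ e}` whose matrix coefficients `g ↦ ℓ (g w)` exhaust the functions `φ` with
`φ (z g) = χ z * φ g`: the vectors `w` whose coefficient comes from `σ` then form a
subrepresentation that maps onto `σ` (`exists_surjective_of_matrixCoeff`), which gives both
conclusions (`isJordanHolderFactor_of_surjective`, `cls_le_cls_of_surjective`).

Since `Z` acts on `S_{(t,...,t)}^{⊗ e}` through `N ^ (et)`, which is `χ = N ^ (es)` by the congruence
on `t`, such an `ℓ` only has to separate the cosets `Z g`
(`SeparatesCosets.exists_matrixCoeff_eq`), and this property passes from the factors of a tensor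
product to the product (`SeparatesCosets.tensorRep`). On a single `Sym^t`, take for `ℓ` the evaluation
of forms at a point `(1, α)` with `α` of degree at least three over `F`. A nonscalar element of `G`
does not fix this point of the projective line, so the translates of the point by `G / Z` are
distinct, and for `t ≥ |G|` there is a form of degree `t`, a product of linear ones, that vanishes at
all of them but one (`separatesCosets_evalForm`). Hence `t₀ = |G|` works.
-/

namespace SerreWeights

/-! ### Subquotients of a representation -/

theorem exists_compositionSeries_of_covBy {R M : Type*} [Ring R] [AddCommGroup M] [Module R M]
    [IsNoetherian R M] [IsArtinian R M] {K U : Submodule R M} (h : K ⋖ U) :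
    ∃ s : CompositionSeries (Submodule R M), s.head = ⊥ ∧ s.last = ⊤ ∧
      ∃ i : Fin s.length, s i.castSucc = K ∧ s i.succ = U := by
  obtain ⟨a, ha0, n, han, ha⟩ :=
    exists_covBy_seq_of_wellFoundedLT_wellFoundedGT_of_le (bot_le : ⊥ ≤ K)
  obtain ⟨b, hb0, m, hbm, hb⟩ :=
    exists_covBy_seq_of_wellFoundedLT_wellFoundedGT_of_le (le_top : U ≤ ⊤)
  let c : ℕ → Submodule R M := fun i => if i ≤ n then a i else b (i - (n + 1))
  have hc : ∀ i < n + 1 + m, c i ⋖ c (i + 1) := by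
    intro i hi
    rcases lt_trichotomy i n with hin | rfl | hin
    · simpa [c, hin.le, Nat.succ_le_of_lt hin] using ha i hin
    · simpa [c, han, hb0] using h
    · have h1 : i + 1 - (n + 1) = i - (n + 1) + 1 := by omega
      have h2 : ¬ i ≤ n := by omega
      have h3 : ¬ i + 1 ≤ n := by omega
      simp only [c, h2, h3, if_false, h1]
      exact hb _ (by omega)
  refine ⟨⟨n + 1 + m, fun i => c i, fun i => hc i i.2⟩, ?_, ?_, ⟨n, by simp; omega⟩, ?_, ?_⟩
  · simpa [RelSeries.head, c] using ha0
  · have h2 : ¬ n + 1 + m ≤ n := by omega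
    simpa [RelSeries.last, c, h2] using hbm
  · simpa [c] using han
  · simpa [c] using hb0

section

variable {k : Type*} {G : Type*} [Field k] [Group G] {V W : Type*} [AddCommGroup V] [Module k V]
  [AddCommGroup W] [Module k W] {σ : Representation k G V} {ρ : Representation k G W}

/-- A simple subquotient of a finite-dimensional representation is a Jordan–Hölder factor. -/
theorem isJordanHolderFactor_of_surjective [FiniteDimensional k W] (hσ : σ.IsIrreducible)
    (U : Subrepresentation ρ) (π : Representation.IntertwiningMap U.toRepresentation σ)
    (hπ : Function.Surjective π) : IsJordanHolderFactor σ ρ := by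
  let U' : Submodule k[G] ρ.asModule := U.asSubmodule
  let q₀ : U' →+ σ.asModule :=
    { toFun := fun w => π ⟨w.1, w.2⟩
      map_zero' := map_zero π
      map_add' := fun x y => map_add π ⟨x.1, x.2⟩ ⟨y.1, y.2⟩ }
  have hsingle : ∀ (g : G) (a : k) (x : U'),
      q₀ (MonoidAlgebra.single g a • x) = MonoidAlgebra.single g a • q₀ x := fun g a x => by
    have h1 : q₀ (MonoidAlgebra.single g a • x) = π (a • U.toRepresentation g ⟨x.1, x.2⟩) :=
      congrArg π (Subtype.ext (Representation.single_smul ρ a g x.1))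
    rw [h1, Representation.single_smul σ a g (q₀ x)]
    exact (map_smul π _ _).trans (congrArg (a • ·) (π.isIntertwining _ _ g _))
  let q : U' →ₗ[k[G]] σ.asModule :=
    { q₀ with
      map_smul' := fun r x => by
        change q₀ (r • x) = r • q₀ x
        induction r using MonoidAlgebra.induction_linear with
        | zero => rw [zero_smul, zero_smul, map_zero]
        | add r s hr hs => rw [add_smul, add_smul, ← hr, ← hs, map_add]
        | single g a => exact hsingle g a x }
  have hq : Function.Surjective q := fun v => by
    obtain ⟨w, hw⟩ := hπ v
    exact ⟨⟨w.1, w.2⟩, hw⟩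
  let K' : Submodule k[G] ρ.asModule := (LinearMap.ker q).map U'.subtype
  have hK : K'.submoduleOf U' = LinearMap.ker q :=
    Submodule.comap_map_eq_of_injective U'.injective_subtype _
  have hKU : K' ≤ U' := Submodule.map_subtype_le _ _
  let E : (U' ⧸ K'.submoduleOf U') ≃ₗ[k[G]] σ.asModule :=
    (Submodule.quotEquivOfEq _ _ hK).trans (q.quotKerEquivOfSurjective hq)
  have : IsSimpleModule k[G] σ.asModule :=
    (Representation.irreducible_iff_isSimpleModule_asModule σ).mp hσ
  have hcov : K' ⋖ U' := (covBy_iff_quot_is_simple hKU).mpr (IsSimpleModule.congr E)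
  have : IsNoetherian k[G] ρ.asModule := isNoetherian_of_tower k inferInstance
  have : IsArtinian k[G] ρ.asModule := isArtinian_of_tower k inferInstance
  obtain ⟨s, h0, h1, i, hiK, hiU⟩ := exists_compositionSeries_of_covBy hcov
  refine ⟨s, h0, h1, i, ?_⟩
  rw [hiK, hiU]
  exact ⟨E⟩

end

section

variable {k : Type u} {G : Type v} [Field k] [Group G]

theorem G₀.cls_eq_add {X Y Z : Type u} [AddCommGroup X] [Module k X] [FiniteDimensional k X]
    [AddCommGroup Y] [Module k Y] [FiniteDimensional k Y]
    [AddCommGroup Z] [Module k Z] [FiniteDimensional k Z]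
    {ρX : Representation k G X} {ρY : Representation k G Y} {ρZ : Representation k G Z}
    (i : Representation.IntertwiningMap ρX ρY) (q : Representation.IntertwiningMap ρY ρZ)
    (hi : Function.Injective i) (hiq : Function.Exact i q) (hq : Function.Surjective q) :
    G₀.cls ρY = G₀.cls ρX + G₀.cls ρZ := by
  rw [← sub_eq_zero, ← sub_sub]
  exact (QuotientAddGroup.eq_zero_iff _).mpr
    (AddSubgroup.subset_closure ⟨FDRep.of ρX, FDRep.of ρY, FDRep.of ρZ, i, q, hi, hiq, hq, rfl⟩)

variable {V W : Type u} [AddCommGroup V] [Module k V] [FiniteDimensional k V]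
  [AddCommGroup W] [Module k W] [FiniteDimensional k W]
  {σ : Representation k G V} {ρ : Representation k G W}

/-- With `K` the kernel of `π : U → σ`, the difference `[ρ] - [σ]` is the class of `K ⊕ W / U`. -/
theorem cls_le_cls_of_surjective (U : Subrepresentation ρ)
    (π : Representation.IntertwiningMap U.toRepresentation σ) (hπ : Function.Surjective π) :
    G₀.le (G₀.cls σ) (G₀.cls ρ) := by
  let Q := ρ.quotient U.toSubmodule U.apply_mem_toSubmodule
  let K := π.ker.toRepresentation
  have h1 : G₀.cls ρ = G₀.cls U.toRepresentation + G₀.cls Q :=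
    G₀.cls_eq_add ⟨U.toSubmodule.subtype, fun _ => rfl⟩ ⟨U.toSubmodule.mkQ, fun _ => rfl⟩
      U.toSubmodule.injective_subtype
      (LinearMap.exact_subtype_mkQ U.toSubmodule) U.toSubmodule.mkQ_surjective
  have h2 : G₀.cls U.toRepresentation = G₀.cls K + G₀.cls σ :=
    G₀.cls_eq_add ⟨π.ker.toSubmodule.subtype, fun _ => rfl⟩ π
      π.ker.toSubmodule.injective_subtype (LinearMap.exact_subtype_ker_map π.toLinearMap) hπ
  have h3 : G₀.cls (K.prod Q) = G₀.cls K + G₀.cls Q :=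
    G₀.cls_eq_add ⟨LinearMap.inl k _ _, fun _ => by ext <;> simp⟩
      ⟨LinearMap.snd k _ _, fun _ => rfl⟩
      LinearMap.inl_injective Function.Exact.inl_snd LinearMap.snd_surjective
  refine ⟨FDRep.of (K.prod Q), ?_⟩
  change _ = G₀.cls (K.prod Q)
  rw [h3, h1, h2]
  abel

end

section

variable {k : Type*} {G : Type*} [Field k] [Group G] {V W : Type*} [AddCommGroup V] [Module k V]
  [AddCommGroup W] [Module k W] {σ : Representation k G V} {ρ : Representation k G W}

/-- If every matrix coefficient `g ↦ μ (σ g v)` of an irreducible `σ` is also a matrix coefficient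
`g ↦ ℓ (ρ g w)` of `ρ`, for fixed functionals `μ ≠ 0` and `ℓ`, then `σ` is a quotient of a
subrepresentation of `ρ`: the vectors `w` for which `g ↦ ℓ (ρ g w)` comes from `σ` form a
subrepresentation, and `v` is determined by its matrix coefficient since the `v` with vanishing
coefficient form a proper subrepresentation of `σ`. -/
theorem exists_surjective_of_matrixCoeff (hσ : σ.IsIrreducible) (μ : V →ₗ[k] k) (hμ : μ ≠ 0)
    (ℓ : W →ₗ[k] k) (h : ∀ v, ∃ w, ∀ g, ℓ (ρ g w) = μ (σ g v)) :
    ∃ (U : Subrepresentation ρ) (π : Representation.IntertwiningMap U.toRepresentation σ),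
      Function.Surjective π := by
  let A : W →ₗ[k] G → k := LinearMap.pi fun g => ℓ ∘ₗ ρ g
  let B : V →ₗ[k] G → k := LinearMap.pi fun g => μ ∘ₗ σ g
  have hA : ∀ w g, A w g = ℓ (ρ g w) := fun _ _ => rfl
  have hB : ∀ v g, B v g = μ (σ g v) := fun _ _ => rfl
  let N : Subrepresentation σ :=
    { toSubmodule := LinearMap.ker B
      apply_mem_toSubmodule := fun g v hv => by
        rw [LinearMap.mem_ker] at hv ⊢
        funext x
        have := congrFun hv (x * g)
        simpa [hB] using this }
  have hN : N = ⊥ := by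
    refine (hσ.eq_bot_or_eq_top N).resolve_right fun htop => hμ ?_
    ext v
    have hv : v ∈ N := htop ▸ (trivial : v ∈ (⊤ : Submodule k V))
    have := congrFun (LinearMap.mem_ker.mp hv) 1
    simpa [hB] using this
  have hBinj : Function.Injective B := by
    rw [← LinearMap.ker_eq_bot]
    exact congrArg Subrepresentation.toSubmodule hN
  let E := LinearEquiv.ofInjective B hBinj
  let U : Subrepresentation ρ :=
    { toSubmodule := (LinearMap.range B).comap A
      apply_mem_toSubmodule := fun g w ⟨v, hv⟩ => by
        refine ⟨σ g v, funext fun x => ?_⟩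
        have := congrFun hv (x * g)
        simpa [hA, hB] using this }
  obtain ⟨π₀, hπ₀⟩ : ∃ π₀ : U.toSubmodule →ₗ[k] V, ∀ w, B (π₀ w) = A w :=
    ⟨E.symm.toLinearMap ∘ₗ
      (A ∘ₗ U.toSubmodule.subtype).codRestrict (LinearMap.range B) fun w => w.2,
      fun w => congrArg Subtype.val (E.apply_symm_apply ⟨A w, w.2⟩)⟩
  refine ⟨U, ⟨π₀, fun g => LinearMap.ext fun w => hBinj (funext fun x => ?_)⟩, fun v => ?_⟩
  · have := congrFun (hπ₀ w) (x * g)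
    have h2 := congrFun (hπ₀ (U.toRepresentation g w)) x
    rw [LinearMap.comp_apply, LinearMap.comp_apply, h2, hB, ← Module.End.mul_apply, ← map_mul, ← hB,
      this, hA, hA, map_mul]
    rfl
  · obtain ⟨w, hw⟩ := h v
    have hw' : A w = B v := funext hw
    exact ⟨⟨w, ⟨v, hw'.symm⟩⟩, hBinj ((hπ₀ _).trans hw')⟩

end

/-! ### Functionals separating the cosets of a subgroup -/

/-- The functional `ℓ` separates the cosets `Z g` through `ρ`: for each `g` some matrix coefficient
`h ↦ ℓ (ρ h w)` vanishes outside `Z g` but not at `g`. -/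
def SeparatesCosets {k G W : Type*} [Field k] [Group G] [AddCommGroup W] [Module k W]
    (Z : Subgroup G) (ρ : Representation k G W) (ℓ : W →ₗ[k] k) : Prop :=
  ∀ g, ∃ w, ℓ (ρ g w) ≠ 0 ∧ ∀ h, h * g⁻¹ ∉ Z → ℓ (ρ h w) = 0

/-- If `ℓ` separates the cosets of `Z` through `ρ` and `Z` acts on `ρ` by scalars, then every
function on `G` on which `Z` acts by the same scalars is a matrix coefficient `g ↦ ℓ (ρ g w)`. -/
theorem SeparatesCosets.exists_matrixCoeff_eq {k G W : Type*} [Field k] [Group G] [Finite G]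
    [AddCommGroup W] [Module k W] {Z : Subgroup G} {ρ : Representation k G W} {ℓ : W →ₗ[k] k}
    (hℓ : SeparatesCosets Z ρ ℓ) (φ : G → k)
    (hφ : ∀ z ∈ Z, ∃ c : k, ρ z = c • LinearMap.id ∧ ∀ g, φ (z * g) = c * φ g) :
    ∃ w, ∀ g, ℓ (ρ g w) = φ g := by
  classical
  choose w hw hw0 using hℓ
  have := Fintype.ofFinite (Quotient (QuotientGroup.rightRel Z))
  -- a sum over the cosets `Z g` of multiples of vectors whose coefficient lives on `Z g` only
  refine ⟨∑ q : Quotient (QuotientGroup.rightRel Z),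
    (φ q.out / ℓ (ρ q.out (w q.out))) • w q.out, fun h => ?_⟩
  simp only [map_sum, map_smul, smul_eq_mul]
  rw [Finset.sum_eq_single (Quotient.mk _ h)]
  · set g := (Quotient.mk (QuotientGroup.rightRel Z) h).out with hg
    have hz : h * g⁻¹ ∈ Z :=
      QuotientGroup.rightRel_apply.mp (Quotient.exact (Quotient.out_eq (Quotient.mk _ h)))
    obtain ⟨c, hρ, hc⟩ := hφ _ hz
    have h1 : ℓ (ρ h (w g)) = c * ℓ (ρ g (w g)) := by
      conv_lhs => rw [← inv_mul_cancel_right h g, map_mul, hρ]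
      simp
    have h2 : φ h = c * φ g := by rw [← hc, inv_mul_cancel_right]
    rw [h1, h2]
    field_simp [hw g]
  · intro q _ hq
    rw [hw0 q.out h, mul_zero]
    intro hz
    exact hq ((Quotient.out_eq q).symm.trans (Quotient.sound (QuotientGroup.rightRel_apply.mpr hz)))
  · simp

section Tensor

variable {ι k G : Type*} [Fintype ι] [Field k] [Group G] {W : ι → Type*}
  [∀ i, AddCommGroup (W i)] [∀ i, Module k (W i)] {ρ : ∀ i, Representation k G (W i)}

/-- The functional `⨂ w i ↦ ∏ ℓ i (w i)` separates cosets if all `ℓ i` do. -/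
theorem SeparatesCosets.tensorRep [Nonempty ι] {Z : Subgroup G} {ℓ : ∀ i, W i →ₗ[k] k}
    (h : ∀ i, SeparatesCosets Z (ρ i) (ℓ i)) :
    SeparatesCosets Z (tensorRep ρ)
      (PiTensorProduct.lift ((MultilinearMap.mkPiAlgebra k ι k).compLinearMap ℓ)) := by
  intro g
  choose w hw hw0 using fun i => h i g
  have key : ∀ x, PiTensorProduct.lift ((MultilinearMap.mkPiAlgebra k ι k).compLinearMap ℓ)
      (SerreWeights.tensorRep ρ x (PiTensorProduct.tprod k w)) = ∏ i, ℓ i (ρ i x (w i)) := fun x => by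
    change PiTensorProduct.lift _ (PiTensorProduct.map (fun i => ρ i x) _) = _
    simp
  refine ⟨PiTensorProduct.tprod k w, ?_, fun x hx => ?_⟩
  · rw [key]
    exact Finset.prod_ne_zero_iff.mpr fun i _ => hw i
  · rw [key]
    exact Finset.prod_eq_zero (Finset.mem_univ (Classical.arbitrary ι)) (hw0 _ x hx)

theorem tensorRep_apply_of_scalar {c : ι → k} {g : G} (h : ∀ i, ρ i g = c i • LinearMap.id) :
    tensorRep ρ g = (∏ i, c i) • LinearMap.id := by
  refine PiTensorProduct.ext (MultilinearMap.ext fun w => ?_)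
  change PiTensorProduct.map (fun i => ρ i g) (PiTensorProduct.tprod k w) =
    (∏ i, c i) • PiTensorProduct.tprod k w
  simp [h, MultilinearMap.map_smul_univ]

end Tensor

/-! ### Binary forms and the orbit of a generic point -/

section Forms

variable {F k : Type*} [Field F] [Field k]

/-- `α` satisfies no nontrivial polynomial equation of degree at most two over `τ(F)`. -/
def NotQuadratic (τ : F →+* k) (α : k) : Prop :=
  ∀ a b c : F, τ a + τ b * α + τ c * α ^ 2 = 0 → a = 0 ∧ b = 0 ∧ c = 0

theorem exists_notQuadratic [Finite F] [Infinite k] (τ : F →+* k) : ∃ α, NotQuadratic τ α := by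
  classical
  let f : F × F × F → Polynomial k := fun x => Polynomial.C (τ x.1) +
    Polynomial.C (τ x.2.1) * Polynomial.X + Polynomial.C (τ x.2.2) * Polynomial.X ^ 2
  have hfin : (⋃ x : F × F × F, {α | α ∈ (f x).roots}).Finite :=
    Set.finite_iUnion fun x => (f x).roots.toFinset.finite_toSet.subset fun α h => by simpa using h
  obtain ⟨α, hα⟩ := hfin.exists_notMem
  refine ⟨α, fun a b c h => ?_⟩
  have hf : f (a, b, c) = 0 := by
    by_contra hne
    exact hα (Set.mem_iUnion.mpr ⟨(a, b, c), (Polynomial.mem_roots hne).mpr (by simpa [f] using h)⟩)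
  have h0 := congrArg (Polynomial.coeff · 0) hf
  have h1 := congrArg (Polynomial.coeff · 1) hf
  have h2 := congrArg (Polynomial.coeff · 2) hf
  simp [f, Polynomial.coeff_X, Polynomial.coeff_C, Polynomial.coeff_X_pow] at h0 h1 h2
  exact ⟨h0, h1, h2⟩

theorem NotQuadratic.embTwist {p : ℕ} [Fact p.Prime] [CharP F p] {τ₀ : F →+* k} {α : k}
    (h : NotQuadratic τ₀ α) (i : ℕ) : NotQuadratic (embTwist p τ₀ i) α := by
  intro a b c habc
  simpa [iterateFrobenius_def, (Fact.out : p.Prime).ne_zero] using h _ _ _ habc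

/-- The row vector `(1, α) g`. -/
def orbitPoint (τ : F →+* k) (α : k) (g : GL (Fin 2) F) : Fin 2 → k :=
  Matrix.vecMul ![1, α] ((g : Matrix (Fin 2) (Fin 2) F).map τ)

theorem orbitPoint_zero_ne_zero {τ : F →+* k} {α : k} (hα : NotQuadratic τ α) (g : GL (Fin 2) F) :
    orbitPoint τ α g 0 ≠ 0 := by
  intro h
  obtain ⟨h1, h2, -⟩ := hα (g.1 0 0) (g.1 1 0) 0 (by
    simpa [orbitPoint, Matrix.vecMul, dotProduct, Fin.sum_univ_two, mul_comm] using h)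
  have := (Matrix.GeneralLinearGroup.det g).ne_zero
  simp [Matrix.det_fin_two, h1, h2] at this

/-- Two translates of `(1, α)` are proportional only if the matrices agree up to a scalar:
otherwise `α` would be a root of the quadratic polynomial whose roots are the fixed points of a
nonscalar matrix. -/
theorem exists_scalar_of_orbitPoint_proportional {τ : F →+* k} {α : k} (hα : NotQuadratic τ α)
    {g h : GL (Fin 2) F}
    (hgh : orbitPoint τ α g 1 * orbitPoint τ α h 0 = orbitPoint τ α g 0 * orbitPoint τ α h 1) :
    ∃ z : Fˣ, h * g⁻¹ = Matrix.GeneralLinearGroup.scalar (Fin 2) z := by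
  obtain ⟨m, rfl⟩ : ∃ m, h = m * g := ⟨h * g⁻¹, by simp⟩
  have hdet : τ (g.1 0 0 * g.1 1 1 - g.1 0 1 * g.1 1 0) ≠ 0 := by
    rw [← Matrix.det_fin_two]
    exact (map_ne_zero τ).mpr (Matrix.GeneralLinearGroup.det g).ne_zero
  -- with `v = (1, α)`, this is `det (v g, v m g) = det g * det (v, v m)`
  have key : τ (g.1 0 0 * g.1 1 1 - g.1 0 1 * g.1 1 0) *
      (τ (- m.1 0 1) + τ (m.1 0 0 - m.1 1 1) * α + τ (m.1 1 0) * α ^ 2) = 0 := by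
    simp only [orbitPoint, Matrix.vecMul, dotProduct, Fin.sum_univ_two, Matrix.map_apply,
      Units.val_mul, Matrix.mul_apply, map_add, map_mul, map_sub, map_neg] at hgh ⊢
    simp at hgh
    linear_combination hgh
  obtain ⟨h1, h2, h3⟩ := hα _ _ _ ((mul_eq_zero.mp key).resolve_left hdet)
  rw [neg_eq_zero] at h1
  rw [sub_eq_zero] at h2
  have hm : m.1 0 0 ≠ 0 := by
    have := (Matrix.GeneralLinearGroup.det m).ne_zero
    simp [Matrix.det_fin_two, h1] at this
    exact this.1
  refine ⟨Units.mk0 _ hm, ?_⟩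
  rw [mul_inv_cancel_right]
  ext i j
  fin_cases i <;> fin_cases j <;> simp [h1, h2, h3]

/-- Evaluation of binary forms at `(1, α)`. -/
noncomputable def evalForm (α : k) (n : ℕ) : SymSpace k n →ₗ[k] k :=
  (MvPolynomial.aeval ![1, α]).toLinearMap ∘ₗ
    (MvPolynomial.homogeneousSubmodule (Fin 2) k n).subtype

theorem evalForm_symRep_map (τ : F →+* k) (α : k) (n : ℕ) (g : GL (Fin 2) F) (P : SymSpace k n) :
    evalForm α n (symRep k n (Matrix.GeneralLinearGroup.map τ g) P) =
      MvPolynomial.aeval (orbitPoint τ α g) P.1 := by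
  change MvPolynomial.aeval _ (substHom _ P.1) = _
  rw [← AlgHom.comp_apply]
  congr 1
  refine MvPolynomial.algHom_ext fun j => ?_
  simp [substHom, orbitPoint, Matrix.vecMul, dotProduct, mul_comm]

theorem separatesCosets_evalForm [Finite F] {τ : F →+* k} {α : k} (hα : NotQuadratic τ α) {n : ℕ}
    (hn : Nat.card (GL (Fin 2) F) ≤ n) :
    SeparatesCosets (Matrix.GeneralLinearGroup.scalar (Fin 2)).range
      ((symRep k n).comp (Matrix.GeneralLinearGroup.map τ)) (evalForm α n) := by
  classical
  intro g
  have := Fintype.ofFinite (GL (Fin 2) F)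
  let T : Finset (GL (Fin 2) F) :=
    {h | h * g⁻¹ ∉ (Matrix.GeneralLinearGroup.scalar (Fin 2) : Fˣ →* GL (Fin 2) F).range}
  -- `L h` is the linear form vanishing at the translate of `(1, α)` by `h`
  let L : GL (Fin 2) F → MvPolynomial (Fin 2) k := fun h =>
    orbitPoint τ α h 1 • MvPolynomial.X 0 - orbitPoint τ α h 0 • MvPolynomial.X 1
  have hL : ∀ h, (L h).IsHomogeneous 1 := fun h =>
    Submodule.sub_mem (MvPolynomial.homogeneousSubmodule (Fin 2) k 1)
      (Submodule.smul_mem _ _ (MvPolynomial.isHomogeneous_X k 0))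
      (Submodule.smul_mem _ _ (MvPolynomial.isHomogeneous_X k 1))
  have hT : T.card ≤ n := (Finset.card_le_univ T).trans (by rwa [← Nat.card_eq_fintype_card])
  -- the powers of `X 0` only serve to reach the degree `n`
  let P : SymSpace k n := ⟨MvPolynomial.X 0 ^ (n - T.card) * ∏ h ∈ T, L h, by
    have := (MvPolynomial.isHomogeneous_X_pow (R := k) (0 : Fin 2) (n - T.card)).mul
      (MvPolynomial.IsHomogeneous.prod T L (fun _ => 1) fun h _ => hL h)
    simpa [Nat.sub_add_cancel hT] using this⟩
  have hP : ∀ x, evalForm α n (((symRep k n).comp (Matrix.GeneralLinearGroup.map τ)) x P) =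
      orbitPoint τ α x 0 ^ (n - T.card) * ∏ h ∈ T,
        (orbitPoint τ α h 1 * orbitPoint τ α x 0 - orbitPoint τ α h 0 * orbitPoint τ α x 1) := by
    intro x
    refine (evalForm_symRep_map τ α n x P).trans ?_
    simp [P, L, map_prod]
  refine ⟨P, ?_, fun x hx => ?_⟩
  · rw [hP]
    refine mul_ne_zero (pow_ne_zero _ (orbitPoint_zero_ne_zero hα g))
      (Finset.prod_ne_zero_iff.mpr fun h hh h0 => ?_)
    obtain ⟨z, hz⟩ := exists_scalar_of_orbitPoint_proportional hα (sub_eq_zero.mp h0)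
    refine (Finset.mem_filter.mp hh).2 ⟨z⁻¹, ?_⟩
    rw [map_inv, ← hz, mul_inv_rev, inv_inv]
  · rw [hP, Finset.prod_eq_zero (i := x) (by simpa [T] using hx) (by ring), mul_zero]

theorem substHom_scalar_of_isHomogeneous {n : ℕ} (a : k) {P : MvPolynomial (Fin 2) k}
    (hP : P.IsHomogeneous n) : substHom (Matrix.scalar (Fin 2) a) P = a ^ n • P := by
  have hX : ∀ j : Fin 2, ∑ i, Matrix.scalar (Fin 2) a i j •
      (MvPolynomial.X i : MvPolynomial (Fin 2) k) = a • MvPolynomial.X j := fun j => by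
    simp [Matrix.scalar_apply, Matrix.diagonal_apply]
  conv_lhs => rw [P.as_sum]
  conv_rhs => rw [P.as_sum]
  rw [map_sum, Finset.smul_sum]
  refine Finset.sum_congr rfl fun d hd => ?_
  rw [substHom, MvPolynomial.aeval_monomial, MvPolynomial.monomial_eq,
    hP.degree_eq_sum_deg_support hd]
  simp only [hX, smul_pow, Finsupp.prod, Finset.prod_smul, Finset.prod_pow_eq_pow_sum,
    MvPolynomial.algebraMap_eq, mul_smul_comm]

theorem symRep_map_scalar (τ : F →+* k) (n : ℕ) (z : Fˣ) :
    symRep k n (Matrix.GeneralLinearGroup.map τ (Matrix.GeneralLinearGroup.scalar (Fin 2) z)) =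
      τ z ^ n • LinearMap.id := by
  have hz : ((Matrix.GeneralLinearGroup.map τ (Matrix.GeneralLinearGroup.scalar (Fin 2) z) :
      GL (Fin 2) k) : Matrix (Fin 2) (Fin 2) k) = Matrix.scalar (Fin 2) (τ z) := by
    ext i j
    fin_cases i <;> fin_cases j <;> simp
  refine LinearMap.ext fun P => Subtype.ext ?_
  change substHom _ P.1 = τ z ^ n • P.1
  rw [hz]
  exact substHom_scalar_of_isHomogeneous _ P.2

end Forms

/-- Scalar matrices act on `S_(t,...,t)` through the `t`-th power of the norm. -/
theorem S_apply_scalar (p : ℕ) [Fact p.Prime] {F k : Type*} [Field F] [Finite F] [CharP F p]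
    [Algebra (ZMod p) F] [Field k] [Algebra (ZMod p) k] (τ₀ : F →+* k) (t : ℕ) (z : Fˣ) :
    S p τ₀ (fun _ : Fin (Module.finrank (ZMod p) F) => t)
        (Matrix.GeneralLinearGroup.scalar (Fin 2) z) =
      algebraMap (ZMod p) k (Algebra.norm (ZMod p) (z : F)) ^ t • LinearMap.id := by
  refine (tensorRep_apply_of_scalar
    (ρ := fun i : Fin (Module.finrank (ZMod p) F) => symTwist p τ₀ i t)
    fun i => symRep_map_scalar (embTwist p τ₀ i) t z).trans ?_
  congr 1
  rw [Finset.prod_pow, Subsingleton.elim (algebraMap (ZMod p) k)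
    (τ₀.comp (algebraMap (ZMod p) F)), RingHom.comp_apply,
    FiniteField.algebraMap_norm_eq_prod_pow, Finset.prod_range, map_prod, Nat.card_zmod]
  rfl

end SerreWeights

/-! ### Constituents of `S_{(t,...,t)}^{⊗ e}` -/

/-- Irreducible mod `p` representations of `GL₂(F)` with central character `N_{F/F_p}^{es}` are
constituents of `S_{(t,...,t)}^{⊗ e}` for all large `t ≡ s` modulo `(p-1)/gcd(p-1,e)`. -/
theorem proposition2p1 (p : ℕ) [Fact p.Prime]
    {F : Type*} [Field F] [Finite F] [CharP F p] [Algebra (ZMod p) F]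
    {k : Type u} [Field k] [Algebra (ZMod p) k] [IsAlgClosure (ZMod p) k]
    (τ₀ : F →+* k)
    {V : Type u} [AddCommGroup V] [Module k V] [FiniteDimensional k V]
    (σ : Representation k (GL (Fin 2) F) V) (hσ : σ.IsIrreducible)
    (e s : ℕ) (he : 1 ≤ e) (hs : 1 ≤ s)
    -- the central character of `σ` is the `es`-th power of the norm
    (hc : ∀ z : Fˣ, σ (Matrix.GeneralLinearGroup.scalar (Fin 2) z) =
      algebraMap (ZMod p) k (Algebra.norm (ZMod p) (z : F) ^ (e * s)) • LinearMap.id) :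
    ∃ t₀ : ℕ, ∀ t : ℕ, t₀ ≤ t → t ≡ s [MOD (p - 1) / Nat.gcd (p - 1) e] →
      SerreWeights.IsJordanHolderFactor σ
        (SerreWeights.tensorPowRep e
          (SerreWeights.S p τ₀ fun _ : Fin (Module.finrank (ZMod p) F) => t)) ∧
      SerreWeights.G₀.le (SerreWeights.G₀.cls σ)
        (SerreWeights.G₀.cls (SerreWeights.tensorPowRep e
          (SerreWeights.S p τ₀ fun _ : Fin (Module.finrank (ZMod p) F) => t))) := by
  have : IsAlgClosed k := IsAlgClosure.isAlgClosed (ZMod p)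
  obtain ⟨α, hα⟩ := SerreWeights.exists_notQuadratic τ₀
  refine ⟨Nat.card (GL (Fin 2) F), fun t ht hts => ?_⟩
  have : Nonempty (Fin (Module.finrank (ZMod p) F)) := ⟨⟨0, Module.finrank_pos⟩⟩
  have : Nonempty (Fin e) := ⟨⟨0, he⟩⟩
  have hsep : SerreWeights.SeparatesCosets _ (SerreWeights.tensorPowRep e
      (SerreWeights.S p τ₀ fun _ : Fin (Module.finrank (ZMod p) F) => t)) _ :=
    SerreWeights.SeparatesCosets.tensorRep fun _ => SerreWeights.SeparatesCosets.tensorRep fun i =>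
      SerreWeights.separatesCosets_evalForm (hα.embTwist (p := p) i) ht
  have hmod : t * e ≡ e * s [MOD p - 1] := by
    rw [mul_comm t e]
    refine (hts.mul_left' e).of_dvd ?_
    rw [← Nat.mul_div_assoc _ (Nat.gcd_dvd_left _ _), mul_comm e, Nat.mul_div_assoc _
      (Nat.gcd_dvd_right _ _)]
    exact dvd_mul_right _ _
  obtain ⟨x, hx⟩ : ∃ x : V, x ≠ 0 := by
    by_contra! h
    refine bot_ne_top (α := Subrepresentation σ) (SetLike.ext fun x => ?_)
    rw [h x]
    exact ⟨fun _ => trivial, fun _ => rfl⟩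
  obtain ⟨μ, hμx⟩ := Module.Projective.exists_dual_ne_zero k hx
  obtain ⟨U, π, hπ⟩ := SerreWeights.exists_surjective_of_matrixCoeff hσ μ
    (fun h => hμx (by rw [h]; rfl)) _ fun v =>
      hsep.exists_matrixCoeff_eq (fun g => μ (σ g v)) (by
        rintro _ ⟨z, rfl⟩
        refine ⟨_, SerreWeights.tensorRep_apply_of_scalar fun _ =>
          SerreWeights.S_apply_scalar p τ₀ t z, fun g => ?_⟩
        have hN : Algebra.norm (ZMod p) (z : F) ≠ 0 := Algebra.norm_ne_zero_iff.mpr z.ne_zero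
        rw [Finset.prod_const, Finset.card_univ, Fintype.card_fin, ← pow_mul, ← map_pow,
          pow_eq_pow_of_modEq hmod (ZMod.pow_card_sub_one_eq_one hN), map_mul, hc]
        simp)
  exact ⟨SerreWeights.isJordanHolderFactor_of_surjective hσ U π hπ,
    SerreWeights.cls_le_cls_of_surjective U π hπ⟩
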